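/- Let $d\ge 1$ be an integer. There exist constants $K,N>0$, depending only on $d$, such that the following holds. Let $r\ge 2$ be an integer, let $P$ be a finite set of $n$ points in $\mathbb{R}^d$, and let $L$ be a finite set of (affine) lines in $\mathbb{R}^d$ such that each line of $L$ contains at least $r$ points of $P$. If $$|L|\ \ge\ K\,\frac{n^2}{r^{d+1}},$$ then there exists an affine hyperplane in $\mathbb{R}^d$ (a nonempty affine subspace of dimension $d-1$) that contains at least $N\,\dfrac{n}{r^{d-1}}$ points of $P$. -/

import Mathlib

namespace RichLines

/-- An affine line in a real affine (vector) space: an affine subspace of dimension one. (The empty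
affine subspace has zero-dimensional direction, so a line is automatically nonempty.) -/
def IsLine {V : Type*} [AddCommGroup V] [Module ℝ V] (l : AffineSubspace ℝ V) : Prop :=
  Module.finrank ℝ l.direction = 1

/-- An affine hyperplane: a nonempty affine subspace of codimension one. -/
def IsHyperplane {V : Type*} [AddCommGroup V] [Module ℝ V] (H : AffineSubspace ℝ V) : Prop :=
  (H : Set V).Nonempty ∧ Module.finrank ℝ H.direction + 1 = Module.finrank ℝ V

end RichLines

/-! The proof is the polynomial method with one twist: a single polynomial of degree about `r` must
vanish on most of the lines although `P` may be too large for plain interpolation. Let `V` be the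
polynomials of degree at most `m` in each variable, with `m` about `r / d`. Points act on `V` by
evaluation, and points on one line span few functionals (`IsLine.rankOn_eval_le`), so a rich line is
a large block of low rank. `exists_stable_subspace` picks a nonzero `E ≤ V` minimising the number of
points not killed by `E`, per dimension. On this `E` a Forster-type rescaling
(`exists_scaling_leverage_eq`) gives the surviving evaluations a Gram matrix with constant diagonal
and bounded row energy. A low-rank block needs much off-diagonal energy, and blocks of different
lines share no off-diagonal entries, so few lines can have half of their points surviving
(`card_blocks_le`). Every other line has more zeros of any `f ∈ E` than `deg f`, so `f` vanishes on
it. Among the lines in the zero set of `f`, pass to a subfamily with large minimum degrees and take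
a nonzero `g` of least degree vanishing on it. Some partial derivative of `g` is nonzero at a point
`p` on many lines, and the tangent hyperplane of `g` at `p` contains all of them
(`exists_hyperplane_of_vanishing`). -/

namespace RichLines

open Matrix Finset Module

/-! ### Rank of subfamilies. -/

section RankOn

variable {ι V : Type*} [AddCommGroup V] [Module ℝ V] (v : ι → V)

/-- The rank of a finite subfamily. -/
noncomputable def rankOn (F : Finset ι) : ℕ := finrank ℝ (Submodule.span ℝ (v '' F))

@[simp]
theorem rankOn_empty : rankOn v ∅ = 0 := by
  rw [rankOn, coe_empty, Set.image_empty, Submodule.span_empty, finrank_bot]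

theorem rankOn_insert_of_mem [DecidableEq ι] {F : Finset ι} {a : ι}
    (ha : v a ∈ Submodule.span ℝ (v '' F)) : rankOn v (insert a F) = rankOn v F := by
  rw [rankOn, rankOn, coe_insert, Set.image_insert_eq, Submodule.span_insert_eq_span ha]

theorem rankOn_insert_of_notMem [FiniteDimensional ℝ V] [DecidableEq ι] {F : Finset ι} {a : ι}
    (ha : v a ∉ Submodule.span ℝ (v '' F)) : rankOn v (insert a F) = rankOn v F + 1 := by
  rw [rankOn, rankOn, coe_insert, Set.image_insert_eq, Submodule.span_insert, sup_comm,
    Submodule.finrank_sup_span_singleton ha]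

theorem rankOn_mono [FiniteDimensional ℝ V] {F F' : Finset ι} (h : F ⊆ F') :
    rankOn v F ≤ rankOn v F' :=
  Submodule.finrank_mono (Submodule.span_mono (Set.image_mono (by simpa using h)))

theorem rankOn_comp_le [FiniteDimensional ℝ V] {W : Type*} [AddCommGroup W] [Module ℝ W]
    (f : V →ₗ[ℝ] W) (F : Finset ι) : rankOn (fun x => f (v x)) F ≤ rankOn v F := by
  have : (fun x => f (v x)) '' F = f '' (v '' F) := (Set.image_image _ _ _).symm
  rw [rankOn, this, ← Submodule.map_span]
  exact Submodule.finrank_map_le _ _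

end RankOn

/-! ### Moment matrices and Forster-type scaling. -/

/-- The regularised second-moment matrix `1 + ∑ w x • v x (v x)ᵀ` of a weighted family. -/
noncomputable def moment {ι κ : Type*} [Fintype κ] [DecidableEq κ] (v : ι → κ → ℝ) (w : ι → ℝ)
    (F : Finset ι) : Matrix κ κ ℝ :=
  1 + ∑ x ∈ F, w x • vecMulVec (v x) (v x)

section Moment

variable {ι κ : Type*} [Fintype κ] [DecidableEq κ] (v : ι → κ → ℝ) {w : ι → ℝ}

theorem moment_posDef (hw : ∀ x, 0 ≤ w x) (F : Finset ι) : (moment v w F).PosDef := by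
  refine Matrix.PosDef.one.add_posSemidef (Matrix.posSemidef_sum _ fun x _ => ?_)
  exact (posSemidef_vecMulVec_self_star (v x)).smul (hw x)

theorem moment_insert [DecidableEq ι] (w : ι → ℝ) {F : Finset ι} {a : ι} (ha : a ∉ F) :
    moment v w (insert a F) = moment v w F + w a • vecMulVec (v a) (v a) := by
  simp only [moment, sum_insert ha]; abel

theorem det_add_smul_vecMulVec {B : Matrix κ κ ℝ} (hB : IsUnit B.det) (s : ℝ) (u : κ → ℝ) :
    (B + s • vecMulVec u u).det = B.det * (1 + s * (u ⬝ᵥ B⁻¹ *ᵥ u)) := by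
  have h := det_add_replicateCol_mul_replicateRow (ι := Unit) hB (s • u) u
  rw [← vecMulVec_eq, smul_vecMulVec] at h
  rw [h]
  congr 1
  rw [det_unique]
  rw [Matrix.add_apply, one_apply_eq, Matrix.mul_assoc, ← replicateCol_mulVec,
    replicateRow_mul_replicateCol_apply, mulVec_smul, dotProduct_smul, smul_eq_mul]

theorem posDef_inv_form_nonneg {B : Matrix κ κ ℝ} (hB : B.PosDef) (u : κ → ℝ) :
    0 ≤ u ⬝ᵥ B⁻¹ *ᵥ u := by
  simpa using hB.inv.posSemidef.dotProduct_mulVec_nonneg u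

/-- A vector outside the span of a family has a leverage bounded below, uniformly in the weights. -/
theorem exists_leverage_lower_bound (F : Finset ι) (a : ι)
    (ha : v a ∉ Submodule.span ℝ (v '' F)) :
    ∃ δ : ℝ, 0 < δ ∧ ∀ w : ι → ℝ, (∀ x, 0 ≤ w x) → δ ≤ v a ⬝ᵥ (moment v w F)⁻¹ *ᵥ v a := by
  -- The vector `u` representing `f` is orthogonal to the family, so the moment matrix fixes it for
  -- all weights. Cauchy–Schwarz for the inverse form then bounds the leverage independently of `w`.
  obtain ⟨f, hfa, hf⟩ := Submodule.exists_le_ker_of_notMem ha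
  set u : κ → ℝ := fun i => f fun j => if i = j then 1 else 0 with hu
  have hfu : ∀ y, f y = y ⬝ᵥ u := fun y => by
    rw [LinearMap.pi_apply_eq_sum_univ f y]; rfl
  have hua : v a ⬝ᵥ u ≠ 0 := by rwa [← hfu]
  have huu : 0 < u ⬝ᵥ u := by
    refine lt_of_le_of_ne (by simpa using dotProduct_self_star_nonneg u) fun h => hua ?_
    rw [dotProduct_self_eq_zero.1 h.symm, dotProduct_zero]
  refine ⟨(v a ⬝ᵥ u) ^ 2 / (u ⬝ᵥ u), by positivity, fun w hw => ?_⟩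
  have hpd := moment_posDef v hw F
  have hB : IsUnit (moment v w F).det := hpd.det_pos.ne'.isUnit
  set B := moment v w F with hBdef
  have hBu : B *ᵥ u = u := by
    rw [hBdef, moment, add_mulVec, one_mulVec, sum_mulVec, sum_eq_zero, add_zero]
    intro x hx
    have : v x ⬝ᵥ u = 0 := by
      rw [← hfu]; exact hf (Submodule.subset_span ⟨x, hx, rfl⟩)
    rw [smul_mulVec, vecMulVec_mulVec, this]
    simp
  have hBu' : B⁻¹ *ᵥ u = u := by
    conv_lhs => rw [← hBu, mulVec_mulVec, nonsing_inv_mul _ hB, one_mulVec]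
  have hsymm : u ⬝ᵥ B⁻¹ *ᵥ v a = v a ⬝ᵥ u := by
    have ht : (B⁻¹)ᵀ = B⁻¹ := by simpa using hpd.inv.isHermitian.eq
    rw [dotProduct_mulVec, ← mulVec_transpose, ht, hBu', dotProduct_comm]
  have hq := posDef_inv_form_nonneg hpd (v a - ((v a ⬝ᵥ u) / (u ⬝ᵥ u)) • u)
  rw [mulVec_sub, mulVec_smul, hBu', sub_dotProduct, dotProduct_sub, dotProduct_sub,
    smul_dotProduct, dotProduct_smul, smul_dotProduct, dotProduct_smul, hsymm] at hq
  simp only [smul_eq_mul] at hq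
  rw [div_mul_cancel₀ _ huu.ne'] at hq
  rw [sq, mul_div_assoc]
  linarith [mul_comm (v a ⬝ᵥ u / u ⬝ᵥ u) (v a ⬝ᵥ u)]

theorem det_moment_le_insert [DecidableEq ι] (hw : ∀ x, 0 ≤ w x) {F : Finset ι} {a : ι}
    (ha : a ∉ F) : (moment v w F).det ≤ (moment v w (insert a F)).det := by
  have hpd := moment_posDef v hw F
  rw [moment_insert v w ha, det_add_smul_vecMulVec hpd.det_pos.ne'.isUnit]
  have := mul_nonneg (hw a) (posDef_inv_form_nonneg hpd (v a))
  nlinarith [hpd.det_pos]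

theorem monotone_det_moment [DecidableEq ι] (hw : ∀ x, 0 ≤ w x) :
    Monotone fun F => (moment v w F).det :=
  monotone_iff_forall_le_insert.2 fun _ _ ha => det_moment_le_insert v hw ha

/-- Insert the vectors in decreasing order of `t`: each one that raises the rank multiplies the
determinant by at least a constant times `exp (t a)`. Summation by parts against `c * #F ≤ rankOn v
F` turns this greedy sum into `c * ∑ t`; the term in `s` carries the induction. -/
theorem log_det_moment_lower_bound [Finite ι] [DecidableEq ι] :
    ∃ C : ℝ, 0 ≤ C ∧ ∀ c : ℝ, (∀ F : Finset ι, c * #F ≤ rankOn v F) →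
      ∀ (t : ι → ℝ) (F : Finset ι) (s : ℝ), (∀ x ∈ F, s ≤ t x) →
        c * ∑ x ∈ F, t x + (rankOn v F - c * #F) * s - C * rankOn v F ≤
          Real.log (moment v (fun x => Real.exp (t x)) F).det := by
  have key : ∀ p : Finset ι × ι, ∃ δ : ℝ, 0 < δ ∧ (v p.2 ∉ Submodule.span ℝ (v '' p.1) →
      ∀ w : ι → ℝ, (∀ x, 0 ≤ w x) → δ ≤ v p.2 ⬝ᵥ (moment v w p.1)⁻¹ *ᵥ v p.2) := by
    intro p
    by_cases h : v p.2 ∈ Submodule.span ℝ (v '' p.1)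
    · exact ⟨1, one_pos, fun h' => absurd h h'⟩
    · obtain ⟨δ, h0, h1⟩ := exists_leverage_lower_bound v p.1 p.2 h
      exact ⟨δ, h0, fun _ => h1⟩
  choose δ hδ hlev using key
  obtain ⟨C, hC⟩ := (Set.finite_range fun p => -Real.log (δ p)).bddAbove
  refine ⟨max C 0, le_max_right _ _, fun c hc t F => ?_⟩
  have hCδ : ∀ p, -Real.log (δ p) ≤ max C 0 := fun p =>
    (hC ⟨p, rfl⟩).trans (le_max_left _ _)
  set D := max C 0
  have hw : ∀ x, 0 ≤ Real.exp (t x) := fun x => (Real.exp_pos _).le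
  induction F using Finset.induction_on_min_value t with
  | empty => intro s _; simp [moment]
  | insert a F ha hmin ih =>
    intro s hs
    have h1 := ih (t a) hmin
    have h2 := mul_le_mul_of_nonneg_left (hs a (mem_insert_self _ _))
      (sub_nonneg.2 (hc (insert a F)))
    rw [card_insert_of_notMem ha] at h2 ⊢
    rw [sum_insert ha]
    have hpos := (moment_posDef v hw F).det_pos
    by_cases hv : v a ∈ Submodule.span ℝ (v '' F)
    · have h3 := Real.log_le_log hpos (det_moment_le_insert v hw ha)
      rw [rankOn_insert_of_mem v hv] at h2 ⊢
      push_cast at h2 ⊢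
      linarith
    · rw [rankOn_insert_of_notMem v hv] at h2 ⊢
      have h3 := hlev (F, a) hv _ hw
      have h4 : t a - D ≤ Real.log (1 + Real.exp (t a) *
          (v a ⬝ᵥ (moment v (fun x => Real.exp (t x)) F)⁻¹ *ᵥ v a)) := by
        have h5 : Real.exp (t a) * δ (F, a) ≤ 1 + Real.exp (t a) *
          (v a ⬝ᵥ (moment v (fun x => Real.exp (t x)) F)⁻¹ *ᵥ v a) := by
          have := mul_le_mul_of_nonneg_left h3 (hw a)
          simp only at this
          linarith
        have h6 := Real.log_le_log (mul_pos (Real.exp_pos _) (hδ _)) h5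
        rw [Real.log_mul (Real.exp_pos _).ne' (hδ _).ne', Real.log_exp] at h6
        linarith [hCδ (F, a)]
      rw [moment_insert v _ ha, det_add_smul_vecMulVec hpos.ne'.isUnit, Real.log_mul hpos.ne']
      · push_cast at h2 ⊢
        linarith
      · have := mul_nonneg (hw a) (posDef_inv_form_nonneg (moment_posDef v hw F) (v a))
        linarith

/-- **Forster-type scaling.** If every subfamily has rank at least `2c` times its size, then the
vectors can be rescaled so that all leverages of the moment matrix are equal to `c`. -/
theorem exists_scaling_leverage_eq [Fintype ι] {c : ℝ} (hc0 : 0 < c)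
    (hc : ∀ F : Finset ι, 2 * c * #F ≤ rankOn v F) :
    ∃ w : ι → ℝ, (∀ x, 0 < w x) ∧
      ∀ x, w x * (v x ⬝ᵥ (moment v w univ)⁻¹ *ᵥ v x) = c := by
  classical
  obtain ⟨C, hC0, hC⟩ := log_det_moment_lower_bound v
  let M : (ι → ℝ) → Matrix κ κ ℝ := fun t => moment v (fun x => Real.exp (t x)) univ
  have hpd : ∀ t, (M t).PosDef := fun t => moment_posDef v (fun x => (Real.exp_pos _).le) _
  -- At a maximum of `Ψ`, each partial derivative, `c` minus a leverage, is zero.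
  let Ψ : (ι → ℝ) → ℝ := fun t => c * ∑ x, t x - Real.log (M t).det
  have hM : Continuous M := by
    unfold M moment
    fun_prop
  have hΨc : Continuous Ψ := by
    refine Continuous.sub (by fun_prop) (Continuous.log hM.matrix_det fun t => (hpd t).det_pos.ne')
  -- Coercivity: the bound with `2 * c` on the nonnegative coordinates suffices because `∑ |t x|` is
  -- twice their sum minus `∑ t x`. This is where the factor 2 in `hc` is spent.
  have hbound : ∀ t, Ψ t ≤ C * rankOn v univ - c * ‖t‖ := by
    intro t
    have h1 := hC (2 * c) hc t (univ.filter fun x => 0 ≤ t x) 0 (by simp)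
    have h2 := Real.log_le_log (moment_posDef v (fun x => (Real.exp_pos (t x)).le) _).det_pos
      (monotone_det_moment v (fun x => (Real.exp_pos (t x)).le)
        (subset_univ (univ.filter fun x => 0 ≤ t x)))
    have h3 : rankOn v (univ.filter fun x => 0 ≤ t x) ≤ rankOn v univ :=
      rankOn_mono v (subset_univ _)
    have h4 : C * (rankOn v (univ.filter fun x => 0 ≤ t x) : ℝ) ≤ C * rankOn v univ := by
      gcongr
    have h5 : ‖t‖ ≤ ∑ x, |t x| := by
      refine (pi_norm_le_iff_of_nonneg (sum_nonneg fun x _ => abs_nonneg _)).2 fun x => ?_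
      exact single_le_sum (f := fun x => |t x|) (fun x _ => abs_nonneg _) (mem_univ x)
    have h6 : ∑ x, |t x| = 2 * ∑ x ∈ univ.filter (fun x => 0 ≤ t x), t x - ∑ x, t x := by
      rw [sum_filter, mul_sum, ← sum_sub_distrib]
      refine sum_congr rfl fun x _ => ?_
      split_ifs with h
      · rw [abs_of_nonneg h]; ring
      · rw [abs_of_neg (not_le.1 h)]; ring
    have h7 := mul_le_mul_of_nonneg_left h5 hc0.le
    rw [h6] at h7
    simp only [Ψ, M]
    linarith
  obtain ⟨t, ht⟩ := hΨc.exists_forall_ge' 0 (by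
    have hlim : Filter.Tendsto (fun t : ι → ℝ => C * rankOn v univ - c * ‖t‖)
        (Filter.cocompact _) Filter.atBot :=
      by
      simp only [sub_eq_add_neg]
      exact Filter.tendsto_atBot_add_const_left _ _ (Filter.tendsto_neg_atTop_atBot.comp
        (tendsto_norm_cocompact_atTop.const_mul_atTop hc0))
    filter_upwards [hlim.eventually_le_atBot (Ψ 0)] with t ht using (hbound t).trans ht)
  refine ⟨fun x => Real.exp (t x), fun x => Real.exp_pos _, fun x => ?_⟩
  set τ := Real.exp (t x) * (v x ⬝ᵥ (M t)⁻¹ *ᵥ v x) with hτ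
  have hτ0 : 0 ≤ τ := mul_nonneg (Real.exp_pos _).le (posDef_inv_form_nonneg (hpd t) _)
  have hstep : ∀ h : ℝ, M (Function.update t x (t x + h)) =
      M t + (Real.exp (t x) * (Real.exp h - 1)) • vecMulVec (v x) (v x) := by
    intro h
    have e : ∀ t' : ι → ℝ, M t' = 1 + (Real.exp (t' x) • vecMulVec (v x) (v x) +
        ∑ y ∈ univ.erase x, Real.exp (t' y) • vecMulVec (v y) (v y)) := fun t' =>
      congrArg (1 + ·) (add_sum_erase univ (fun y => Real.exp (t' y) • vecMulVec (v y) (v y))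
        (mem_univ x)).symm
    rw [e, e t, sum_congr rfl (fun y hy => by
      rw [Function.update_of_ne (ne_of_mem_erase hy)]), Function.update_self, Real.exp_add,
      mul_sub, sub_smul, mul_one]
    abel
  have hle : ∀ h : ℝ, c * h ≤ Real.log (1 + τ * (Real.exp h - 1)) := by
    intro h
    have h1 := ht (Function.update t x (t x + h))
    have h2 := (hpd (Function.update t x (t x + h))).det_pos
    simp only [Ψ] at h1
    rw [hstep, det_add_smul_vecMulVec (hpd t).det_pos.ne'.isUnit] at h1 h2
    have h3 := (pos_iff_pos_of_mul_pos h2).1 (hpd t).det_pos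
    rw [Real.log_mul (hpd t).det_pos.ne' h3.ne', sum_update_of_mem (mem_univ x),
      sdiff_singleton_eq_erase, ← add_sum_erase univ t (mem_univ x)] at h1
    have h4 : Real.exp (t x) * (Real.exp h - 1) * (v x ⬝ᵥ (M t)⁻¹ *ᵥ v x) =
        τ * (Real.exp h - 1) := by rw [hτ]; ring
    rw [h4] at h1
    linarith
  have hmin : IsLocalMin (fun h : ℝ => Real.log (1 + τ * (Real.exp h - 1)) - c * h) 0 :=
    Filter.Eventually.of_forall fun h => by simpa using hle h
  have hd : HasDerivAt (fun h : ℝ => Real.log (1 + τ * (Real.exp h - 1)) - c * h)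
      (τ * Real.exp 0 / (1 + τ * (Real.exp 0 - 1)) - c * 1) 0 :=
    ((((Real.hasDerivAt_exp 0).sub_const 1).const_mul τ).const_add 1 |>.log (by simp)).sub
      ((hasDerivAt_id 0).const_mul c)
  have h0 := hmin.hasDerivAt_eq_zero hd
  simp only [Real.exp_zero, sub_self, mul_zero, add_zero, mul_one, div_one] at h0
  linarith

end Moment

end RichLines

/-! ### Gram matrices and the energy of low-rank blocks. -/

namespace RichLines

open Matrix Finset Module

/-- For a real symmetric matrix, `(tr A)² ≤ rank A * tr (A²)`. -/
theorem sq_trace_le_rank_mul_trace_sq {ι : Type*} [Fintype ι] [DecidableEq ι] {A : Matrix ι ι ℝ}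
    (hA : A.IsHermitian) : A.trace ^ 2 ≤ A.rank * (A * A).trace := by
  have h1 : A.trace = ∑ i, hA.eigenvalues i := by simpa using hA.trace_eq_sum_eigenvalues
  have h2 : (A * A).trace = ∑ i, hA.eigenvalues i ^ 2 := by
    conv_lhs => rw [hA.spectral_theorem, ← map_mul, diagonal_mul_diagonal,
      Unitary.conjStarAlgAut_apply, trace_mul_comm, ← Matrix.mul_assoc]
    simp [trace, sq]
  rw [h1, h2, hA.rank_eq_card_non_zero_eigs, Fintype.card_subtype, ← sum_filter_ne_zero]
  refine sq_sum_le_card_mul_sum_sq.trans ?_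
  exact mul_le_mul_of_nonneg_left
    (sum_le_univ_sum_of_nonneg fun i => sq_nonneg (hA.eigenvalues i)) (Nat.cast_nonneg _)

/-- Rescaled Gram matrix with constant diagonal. -/
theorem exists_gram_of_rank_condition {ι κ : Type*} [Fintype ι] [Fintype κ] (v : ι → κ → ℝ) {c : ℝ}
    (hc0 : 0 < c) (hc : ∀ F : Finset ι, 2 * c * #F ≤ rankOn v F) :
    ∃ G : ι → ι → ℝ, (∀ x, G x x = c) ∧ (∀ x, ∑ y, G x y ^ 2 ≤ c) ∧
      ∀ Y : Finset ι, (c * #Y) ^ 2 ≤ rankOn v Y * ∑ x ∈ Y, ∑ y ∈ Y, G x y ^ 2 := by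
  classical
  obtain ⟨w, hw, hlev⟩ := exists_scaling_leverage_eq v hc0 hc
  have hpd := moment_posDef v (fun x => (hw x).le) univ
  set B := moment v w univ with hB
  have hBu : IsUnit B.det := hpd.det_pos.ne'.isUnit
  have ht : (B⁻¹)ᵀ = B⁻¹ := by simpa using hpd.inv.isHermitian.eq
  let H : Matrix κ ι ℝ := of fun i x => √(w x) * v x i
  have hBH : B = 1 + H * Hᵀ := by
    rw [hB, moment]
    congr 1
    ext i j
    simp only [Matrix.sum_apply, Matrix.mul_apply, H, Matrix.smul_apply, vecMulVec_apply, of_apply,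
      transpose_apply, smul_eq_mul]
    refine sum_congr rfl fun x _ => ?_
    rw [mul_mul_mul_comm, Real.mul_self_sqrt (hw x).le]
  let G : Matrix ι ι ℝ := Hᵀ * B⁻¹ * H
  have hGt : Gᵀ = G := by
    simp only [G, transpose_mul, transpose_transpose, ht, Matrix.mul_assoc]
  have hGs : ∀ x y, G y x = G x y := fun x y => congrFun (congrFun hGt x) y
  have hdiag : ∀ x, G x x = c := fun x => by
    rw [← hlev x]
    have : H.col x = √(w x) • v x := rfl
    have h : G x x = H.col x ⬝ᵥ B⁻¹ *ᵥ H.col x := by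
      simp only [G, Matrix.mul_assoc]
      rfl
    rw [h, this, mulVec_smul, dotProduct_smul, smul_dotProduct, smul_eq_mul, smul_eq_mul,
      ← mul_assoc, Real.mul_self_sqrt (hw x).le]
  -- `G` is a regularised projection, so `G * G ≤ G`; on the diagonal this bounds the row energies
  -- by `c`.
  have hGG : G * G = G - (B⁻¹ * H)ᵀ * (B⁻¹ * H) := by
    have h1 : H * Hᵀ = B - 1 := by rw [hBH]; abel
    calc G * G = Hᵀ * B⁻¹ * (H * Hᵀ) * B⁻¹ * H := by simp only [G, Matrix.mul_assoc]
      _ = Hᵀ * (B⁻¹ * B) * B⁻¹ * H - Hᵀ * B⁻¹ * B⁻¹ * H := by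
        rw [h1, Matrix.mul_sub, Matrix.sub_mul, Matrix.sub_mul]
        simp only [Matrix.mul_assoc, Matrix.one_mul]
      _ = _ := by
        rw [nonsing_inv_mul _ hBu, Matrix.mul_one, transpose_mul, ht]
        simp only [G, Matrix.mul_assoc]
  refine ⟨G, hdiag, fun x => ?_, fun Y => ?_⟩
  · have h1 : ∑ y, G x y ^ 2 = (G * G) x x := by
      rw [Matrix.mul_apply]
      exact sum_congr rfl fun y _ => by rw [hGs x y, sq]
    rw [h1, hGG, Matrix.sub_apply, hdiag, Matrix.mul_apply]
    have : 0 ≤ ∑ j, (B⁻¹ * H)ᵀ x j * (B⁻¹ * H) j x := sum_nonneg fun j _ => mul_self_nonneg _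
    linarith
  · let GY : Matrix Y Y ℝ := G.submatrix (↑) (↑)
    let HY : Matrix κ Y ℝ := H.submatrix id (↑)
    have hGY : GY = HYᵀ * B⁻¹ * HY := rfl
    have hherm : GY.IsHermitian := by
      ext x y
      simpa [GY] using hGs _ _
    have hrank : GY.rank ≤ rankOn v Y := by
      rw [hGY]
      refine (rank_mul_le_right _ _).trans ?_
      rw [rank_eq_finrank_span_cols, rankOn]
      refine Submodule.finrank_mono (Submodule.span_le.2 ?_)
      rintro _ ⟨x, rfl⟩
      exact Submodule.smul_mem _ (√(w x)) (Submodule.subset_span ⟨x, x.2, rfl⟩)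
    have htr : GY.trace = c * #Y := by
      simp [trace, GY, hdiag, mul_comm]
    have hsum : (GY * GY).trace = ∑ x ∈ Y, ∑ y ∈ Y, G x y ^ 2 := by
      rw [trace, ← sum_coe_sort Y]
      refine sum_congr rfl fun x _ => ?_
      rw [diag_apply, Matrix.mul_apply, ← sum_coe_sort Y]
      refine sum_congr rfl fun y _ => ?_
      simp only [GY, submatrix_apply, hGs x y, sq]
    have := sq_trace_le_rank_mul_trace_sq hherm
    rw [htr, hsum] at this
    refine this.trans ?_
    gcongr

/-- Few large low-rank blocks: disjoint off-diagonal energy is bounded by the total energy. -/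
theorem card_blocks_le {ι κ α : Type*} [Fintype ι] [Fintype κ] (v : ι → κ → ℝ) {c : ℝ}
    (hc0 : 0 < c) (hc : ∀ F : Finset ι, 2 * c * #F ≤ rankOn v F) (s : Finset α)
    (Y : α → Finset ι) {ρ : ℕ} (hY : ∀ a ∈ s, ρ ≤ #(Y a)) (hrk : ∀ a ∈ s, 2 * rankOn v (Y a) ≤ #(Y a))
    (hdisj : ∀ a ∈ s, ∀ b ∈ s, a ≠ b → ∀ x ∈ Y a, ∀ y ∈ Y a, x ∈ Y b → y ∈ Y b → x = y) :
    c * (#s * ρ) ≤ Fintype.card ι := by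
  classical
  obtain ⟨G, hd, hsum, hG⟩ := exists_gram_of_rank_condition v hc0 hc
  have hblock : ∀ a ∈ s, c ^ 2 * ρ ≤ ∑ p ∈ (Y a).offDiag, G p.1 p.2 ^ 2 := by
    intro a ha
    set E := ∑ x ∈ Y a, ∑ y ∈ Y a, G x y ^ 2 with hE
    have hE' : E = c ^ 2 * #(Y a) + ∑ p ∈ (Y a).offDiag, G p.1 p.2 ^ 2 := by
      rw [hE, ← sum_product', ← diag_union_offDiag, sum_union (disjoint_diag_offDiag _), sum_diag]
      simp [hd, mul_comm]
    have h1 := hG (Y a)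
    have h2 : (2 * rankOn v (Y a) : ℝ) ≤ #(Y a) := by exact_mod_cast hrk a ha
    have h3 : (ρ : ℝ) ≤ #(Y a) := by exact_mod_cast hY a ha
    have hE0 : 0 ≤ E := sum_nonneg fun x _ => sum_nonneg fun y _ => sq_nonneg _
    rcases Nat.eq_zero_or_pos #(Y a) with h0 | h0
    · have : (ρ : ℝ) = 0 := by
        have := hY a ha
        exact_mod_cast Nat.le_zero.1 (h0 ▸ this)
      rw [this, mul_zero]
      exact sum_nonneg fun p _ => sq_nonneg _
    · have h0' : (0 : ℝ) < #(Y a) := by exact_mod_cast h0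
      -- Rank at most half the size forces energy `2 * c ^ 2 * #(Y a)`; the diagonal accounts for
      -- only half of it.
      have h4 : 2 * c ^ 2 * #(Y a) ≤ E := by
        refine le_of_mul_le_mul_right ?_ h0'
        nlinarith [mul_le_mul_of_nonneg_right h2 hE0]
      nlinarith [sq_nonneg c]
  have htot : ∑ a ∈ s, ∑ p ∈ (Y a).offDiag, G p.1 p.2 ^ 2 ≤ c * Fintype.card ι := by
    rw [← sum_biUnion]
    · calc _ ≤ ∑ p : ι × ι, G p.1 p.2 ^ 2 := sum_le_univ_sum_of_nonneg fun p => sq_nonneg _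
        _ = ∑ x, ∑ y, G x y ^ 2 := Fintype.sum_prod_type _
        _ ≤ ∑ _x : ι, c := sum_le_sum fun x _ => hsum x
        _ = _ := by simp [mul_comm]
    · intro a ha b hb hab
      refine disjoint_left.2 fun p hp hq => ?_
      rw [mem_offDiag] at hp hq
      exact hp.2.2 (hdisj a ha b hb hab _ hp.1 _ hp.2.1 hq.1 hq.2.1)
  have h := (sum_le_sum hblock).trans htot
  rw [sum_const, nsmul_eq_mul] at h
  refine le_of_mul_le_mul_left ?_ hc0
  linarith

end RichLines

/-! ### A subspace satisfying the rank condition. -/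

namespace RichLines

open Finset Module

theorem rankOn_linearEquiv_comp {ι V W : Type*} [AddCommGroup V] [Module ℝ V] [AddCommGroup W]
    [Module ℝ W] (v : ι → V) (φ : V ≃ₗ[ℝ] W) (F : Finset ι) :
    rankOn (fun x => φ (v x)) F = rankOn v F := by
  have : (fun x => φ (v x)) '' F = (φ : V →ₗ[ℝ] W) '' (v '' F) := (Set.image_image _ _ _).symm
  rw [rankOn, rankOn, this, ← Submodule.map_span]
  exact LinearEquiv.finrank_map_eq φ _

theorem rankOn_map {ι κ V : Type*} [AddCommGroup V] [Module ℝ V] (v : ι → V) (i : κ ↪ ι)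
    (F : Finset κ) : rankOn v (F.map i) = rankOn (fun x => v (i x)) F := by
  rw [rankOn, rankOn, coe_map, Set.image_image]

/-- A nonzero subspace `E` on which the functionals that do not vanish identically are as few as
possible relative to `finrank E`; every family of such functionals has large rank on `E`. -/
theorem exists_stable_subspace {ι V : Type*} [Fintype ι] [AddCommGroup V] [Module ℝ V]
    [FiniteDimensional ℝ V] [Nontrivial V] (e : ι → Dual ℝ V) :
    ∃ (E : Submodule ℝ V) (X : Finset ι), E ≠ ⊥ ∧ (∀ x, x ∈ X ↔ ∃ f ∈ E, e x f ≠ 0) ∧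
      #X * finrank ℝ V ≤ Fintype.card ι * finrank ℝ E ∧
      ∀ F ⊆ X, #F * finrank ℝ E ≤ #X * rankOn (fun x => E.dualRestrict (e x)) F := by
  classical
  let X : Submodule ℝ V → Finset ι := fun E => univ.filter fun x => ∃ f ∈ E, e x f ≠ 0
  -- Numerator and denominator are bounded integers, so the ratio takes finitely many values and a
  -- minimiser exists.
  let q : Submodule ℝ V → ℚ := fun E => (#(X E) : ℚ) / finrank ℝ E
  have hfin : (q '' {E | E ≠ ⊥}).Finite := by
    refine ((Set.finite_Iic (Fintype.card ι)).image2 (fun a b : ℕ => (a : ℚ) / b)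
      (Set.finite_Iic (finrank ℝ V))).subset ?_
    rintro _ ⟨E, -, rfl⟩
    exact ⟨#(X E), card_le_univ _, finrank ℝ E, E.finrank_le, rfl⟩
  obtain ⟨_, ⟨E, hE, rfl⟩, hmin⟩ :=
    Set.exists_min_image _ id hfin ⟨q ⊤, ⊤, top_ne_bot, rfl⟩
  have hpos : ∀ E' : Submodule ℝ V, E' ≠ ⊥ → 0 < finrank ℝ E' := fun E' h => by
    have := (Submodule.nontrivial_iff_ne_bot).2 h
    exact finrank_pos
  have hle : ∀ E' : Submodule ℝ V, E' ≠ ⊥ → #(X E) * finrank ℝ E' ≤ #(X E') * finrank ℝ E := by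
    intro E' hE'
    have h := hmin _ ⟨E', hE', rfl⟩
    have h1 : (0 : ℚ) < finrank ℝ E := by exact_mod_cast hpos E hE
    have h2 : (0 : ℚ) < finrank ℝ E' := by exact_mod_cast hpos E' hE'
    simp only [id, q] at h
    rw [div_le_div_iff₀ h1 h2] at h
    exact_mod_cast h
  refine ⟨E, X E, hE, fun x => by simp [X], ?_, fun F hF => ?_⟩
  · have h := hle ⊤ top_ne_bot
    rw [finrank_top] at h
    exact h.trans (Nat.mul_le_mul_right _ (card_le_univ _))
  · let W : Submodule ℝ (Dual ℝ E) := Submodule.span ℝ ((fun x => E.dualRestrict (e x)) '' F)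
    have hdim : rankOn (fun x => E.dualRestrict (e x)) F + finrank ℝ W.dualCoannihilator =
      finrank ℝ E := Subspace.finrank_add_finrank_dualCoannihilator_eq W
    have hdimE' : finrank ℝ (W.dualCoannihilator.map E.subtype) = finrank ℝ W.dualCoannihilator :=
      
      Submodule.finrank_map_subtype_eq _ _
    have hsub : X (W.dualCoannihilator.map E.subtype) ⊆ X E \ F := by
      intro x hx
      obtain ⟨-, _, ⟨f, hf, rfl⟩, hfx⟩ := mem_filter.1 hx
      refine mem_sdiff.2 ⟨mem_filter.2 ⟨mem_univ _, f, f.2, hfx⟩, fun hxF => hfx ?_⟩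
      exact (Submodule.mem_dualCoannihilator _).1 hf _ (Submodule.subset_span ⟨x, hxF, rfl⟩)
    have hcard := card_le_card hsub
    rw [card_sdiff_of_subset hF] at hcard
    have hFX := card_le_card hF
    by_cases hb : W.dualCoannihilator.map E.subtype = ⊥
    · rw [hb, finrank_bot] at hdimE'
      rw [← hdimE', add_zero] at hdim
      rw [hdim]
      exact Nat.mul_le_mul_right _ hFX
    · have h := hle _ hb
      rw [hdimE'] at h
      have h' := h.trans (Nat.mul_le_mul_right _ hcard)
      zify [hFX] at h' hdim ⊢
      nlinarith

/-- There is a nonzero subspace `E` such that few large low-rank blocks consist of functionals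
that do not vanish on `E`. -/
theorem exists_subspace_card_blocks_le {ι V : Type*} [Fintype ι] [AddCommGroup V] [Module ℝ V]
    [FiniteDimensional ℝ V] [Nontrivial V] (e : ι → Dual ℝ V) :
    ∃ E : Submodule ℝ V, E ≠ ⊥ ∧ ∀ {α : Type*} (s : Finset α) (Y : α → Finset ι) (ρ : ℕ),
      0 < ρ → (∀ a ∈ s, ρ ≤ #(Y a)) → (∀ a ∈ s, 2 * rankOn e (Y a) ≤ ρ) →
      (∀ a ∈ s, ∀ x ∈ Y a, ∃ f ∈ E, e x f ≠ 0) →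
      (∀ a ∈ s, ∀ b ∈ s, a ≠ b → ∀ x ∈ Y a, ∀ y ∈ Y a, x ∈ Y b → y ∈ Y b → x = y) →
      #s * ρ * finrank ℝ V ≤ 2 * Fintype.card ι ^ 2 := by
  classical
  obtain ⟨E, X, hE, hX, hXle, hrank⟩ := exists_stable_subspace e
  refine ⟨E, hE, fun {α} s Y ρ hρ0 hρ hrk hne hdisj => ?_⟩
  rcases X.eq_empty_or_nonempty with hX0 | hXne
  · have : s = ∅ := by
      refine eq_empty_of_forall_notMem fun a ha => ?_
      obtain ⟨x, hx⟩ := card_pos.1 (hρ0.trans_le (hρ a ha))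
      have := (hX x).2 (hne a ha x hx)
      simp [hX0] at this
    simp [this]
  have := (Submodule.nontrivial_iff_ne_bot).2 hE
  obtain ⟨φ⟩ : Nonempty (Dual ℝ E ≃ₗ[ℝ] (Fin (finrank ℝ (Dual ℝ E)) → ℝ)) :=
    ⟨(finBasis ℝ (Dual ℝ E)).equivFun⟩
  let u : ι → Dual ℝ E := fun x => E.dualRestrict (e x)
  let v : X → Fin (finrank ℝ (Dual ℝ E)) → ℝ := fun x => φ (u x)
  have hrv : ∀ F : Finset X, rankOn v F = rankOn u (F.map (Function.Embedding.subtype _)) :=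
    fun F => (rankOn_linearEquiv_comp (fun x : X => u x) φ F).trans
      (rankOn_map u (Function.Embedding.subtype _) F).symm
  have hq : (0 : ℝ) < finrank ℝ E := by exact_mod_cast finrank_pos
  have hN : (0 : ℝ) < #X := by exact_mod_cast hXne.card_pos
  -- With this `c`, the hypothesis of `card_blocks_le` is exactly the stability of `E`.
  set c : ℝ := finrank ℝ E / (2 * #X) with hc
  have hc0 : 0 < c := by positivity
  have hcond : ∀ F : Finset X, 2 * c * #F ≤ rankOn v F := by
    intro F
    have h := hrank (F.map (Function.Embedding.subtype _)) fun x hx => by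
      obtain ⟨y, -, rfl⟩ := mem_map.1 hx
      exact y.2
    rw [card_map] at h
    rw [hrv, hc]
    have h' : (#F * finrank ℝ E : ℝ) ≤ #X * rankOn u (F.map (Function.Embedding.subtype _)) := by
      exact_mod_cast h
    have : 2 * ((finrank ℝ E : ℝ) / (2 * #X)) * #F = #F * finrank ℝ E / #X := by
      field_simp
    rw [this, div_le_iff₀ hN]
    linarith
  have hsubX : ∀ a ∈ s, ((Y a).subtype (· ∈ X)).map (Function.Embedding.subtype _) = Y a :=
    fun a ha => subtype_map_of_mem fun x hx => (hX x).2 (hne a ha x hx)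
  have hcardY : ∀ a ∈ s, #((Y a).subtype (· ∈ X)) = #(Y a) := fun a ha => by
    rw [← hsubX a ha, card_map, hsubX a ha]
  have hmain := card_blocks_le v hc0 hcond s (fun a => (Y a).subtype (· ∈ X)) (ρ := ρ)
    (fun a ha => by rw [hcardY a ha]; exact hρ a ha)
    (fun a ha => by
      rw [hcardY a ha, hrv, hsubX a ha]
      have := rankOn_comp_le e E.dualRestrict (Y a)
      exact (Nat.mul_le_mul_left 2 this).trans ((hrk a ha).trans (hρ a ha)))
    (fun a ha b hb hab x hx y hy hxb hyb => Subtype.ext <| hdisj a ha b hb hab _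
      (mem_subtype.1 hx) _ (mem_subtype.1 hy) (mem_subtype.1 hxb) (mem_subtype.1 hyb))
  rw [Fintype.card_coe] at hmain
  have h1 : (finrank ℝ E : ℝ) * (#s * ρ) ≤ 2 * #X ^ 2 := by
    rw [hc, div_mul_eq_mul_div, div_le_iff₀ (by positivity)] at hmain
    linarith
  have h2 : (#X * finrank ℝ V : ℝ) ≤ Fintype.card ι * finrank ℝ E := by exact_mod_cast hXle
  have h3 : (#X : ℝ) ≤ Fintype.card ι := by exact_mod_cast card_le_univ X
  have h4 : (#s * ρ * finrank ℝ V : ℝ) ≤ 2 * Fintype.card ι ^ 2 := by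
    refine le_of_mul_le_mul_right ?_ hq
    calc (#s * ρ * finrank ℝ V : ℝ) * finrank ℝ E = finrank ℝ E * (#s * ρ) * finrank ℝ V := by ring
      _ ≤ 2 * #X ^ 2 * finrank ℝ V := by gcongr
      _ = 2 * #X * (#X * finrank ℝ V) := by ring
      _ ≤ 2 * Fintype.card ι * (Fintype.card ι * finrank ℝ E) := by gcongr
      _ = _ := by ring
  exact_mod_cast h4

end RichLines

/-! ### Polynomials restricted to lines. -/

namespace RichLines

open Finset Module

variable {d : ℕ}

section Restrict

open Polynomial

/-- Restriction of a polynomial to the parametrised line `s ↦ p + s • u`. -/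
noncomputable def lineRestrict (p u : EuclideanSpace ℝ (Fin d)) :
    MvPolynomial (Fin d) ℝ →ₐ[ℝ] ℝ[X] :=
  MvPolynomial.aeval fun i => C (p i) + X * C (u i)

theorem eval_lineRestrict (p u : EuclideanSpace ℝ (Fin d)) (f : MvPolynomial (Fin d) ℝ) (s : ℝ) :
    (lineRestrict p u f).eval s = MvPolynomial.aeval (p + s • u).ofLp f := by
  have : (Polynomial.aeval s).comp (lineRestrict p u) = MvPolynomial.aeval (p + s • u).ofLp := by
    refine MvPolynomial.algHom_ext fun i => ?_
    simp only [lineRestrict, AlgHom.comp_apply, MvPolynomial.aeval_X, map_add, map_mul,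
      Polynomial.aeval_C, Polynomial.aeval_X, PiLp.add_apply, PiLp.smul_apply, smul_eq_mul,
      Algebra.algebraMap_self, RingHom.id_apply]
  rw [← this]
  simp

theorem natDegree_lineRestrict_le (p u : EuclideanSpace ℝ (Fin d)) (f : MvPolynomial (Fin d) ℝ) :
    (lineRestrict p u f).natDegree ≤ f.totalDegree := by
  have h := MvPolynomial.aeval_natDegree_le f le_rfl (fun i => C (p i) + X * C (u i)) (n := 1)
    fun i => by compute_degree
  rwa [mul_one] at h

/-- The chain rule. At parameter `0` it makes the gradient at `p` orthogonal to the direction of any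
line through `p` on which `f` vanishes. -/
theorem derivative_lineRestrict (p u : EuclideanSpace ℝ (Fin d)) (f : MvPolynomial (Fin d) ℝ) :
    derivative (lineRestrict p u f) =
      ∑ i, C (u i) * lineRestrict p u (MvPolynomial.pderiv i f) := by
  classical
  induction f using MvPolynomial.induction_on with
  | C a => simp [lineRestrict]
  | add f g hf hg => simp only [map_add, hf, hg, mul_add, sum_add_distrib]
  | mul_X f j hf =>
    have hX : derivative (lineRestrict p u (MvPolynomial.X j)) = C (u j) := by
      simp [lineRestrict]
    simp only [map_mul, derivative_mul, hf, hX, Derivation.leibniz, MvPolynomial.pderiv_X,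
      smul_eq_mul, map_add, mul_add, sum_add_distrib, sum_mul]
    rw [add_comm]
    congr 1
    · rw [sum_eq_single j]
      · simp [mul_comm]
      · intro i _ hij
        simp [hij.symm]
      · simp
    · exact sum_congr rfl fun i _ => by ring

end Restrict

theorem IsLine.nonempty {l : AffineSubspace ℝ (EuclideanSpace ℝ (Fin d))} (hl : IsLine l) :
    ∃ p, p ∈ l := by
  rcases l.eq_bot_or_nonempty with h | h
  · rw [IsLine, h, AffineSubspace.direction_bot, finrank_bot] at hl
    exact absurd hl zero_ne_one
  · exact h

theorem IsLine.exists_param {l : AffineSubspace ℝ (EuclideanSpace ℝ (Fin d))} (hl : IsLine l)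
    {p : EuclideanSpace ℝ (Fin d)} (hp : p ∈ l) :
    ∃ u : EuclideanSpace ℝ (Fin d), u ≠ 0 ∧ ∀ x, x ∈ l ↔ ∃ s : ℝ, p + s • u = x := by
  obtain ⟨u, hu, hspan⟩ := finrank_eq_one_iff'.1 hl
  refine ⟨u, by simpa using hu, fun x => ⟨fun hx => ?_, ?_⟩⟩
  · obtain ⟨s, hs⟩ := hspan ⟨x - p, AffineSubspace.vsub_mem_direction hx hp⟩
    refine ⟨s, ?_⟩
    have := congrArg Subtype.val hs
    simp only [Submodule.coe_smul] at this
    rw [this]; abel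
  · rintro ⟨s, rfl⟩
    rw [add_comm]
    exact AffineSubspace.vadd_mem_of_mem_direction (Submodule.smul_mem _ s u.2) hp

theorem IsLine.eq_of_mem {l l' : AffineSubspace ℝ (EuclideanSpace ℝ (Fin d))} (hl : IsLine l)
    (hl' : IsLine l') {x y : EuclideanSpace ℝ (Fin d)} (hxy : x ≠ y) (hx : x ∈ l) (hy : y ∈ l)
    (hx' : x ∈ l') (hy' : y ∈ l') : l = l' := by
  have key : ∀ {l : AffineSubspace ℝ (EuclideanSpace ℝ (Fin d))}, IsLine l → x ∈ l → y ∈ l →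
      l.direction = Submodule.span ℝ {y - x} := by
    intro l hl hx hy
    refine (Submodule.eq_of_le_of_finrank_eq ?_ ?_).symm
    · rw [Submodule.span_singleton_le_iff_mem]
      exact AffineSubspace.vsub_mem_direction hy hx
    · rw [finrank_span_singleton (sub_ne_zero.2 hxy.symm)]
      exact hl.symm
  exact AffineSubspace.ext_of_direction_eq ((key hl hx hy).trans (key hl' hx' hy').symm)
    ⟨x, hx, hx'⟩

/-- A polynomial with more zeros on a line than its degree vanishes on the line. -/
theorem IsLine.aeval_eq_zero {l : AffineSubspace ℝ (EuclideanSpace ℝ (Fin d))} (hl : IsLine l)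
    {f : MvPolynomial (Fin d) ℝ} {S : Finset (EuclideanSpace ℝ (Fin d))}
    (hS : ∀ x ∈ S, x ∈ l ∧ MvPolynomial.aeval x.ofLp f = 0) (hcard : f.totalDegree < #S) :
    ∀ x ∈ l, MvPolynomial.aeval x.ofLp f = 0 := by
  obtain ⟨p, hp⟩ := hl.nonempty
  obtain ⟨u, hu, hpar⟩ := hl.exists_param hp
  choose! s hs using fun x => (hpar x).1
  have h0 : lineRestrict p u f = 0 := by
    refine Polynomial.eq_zero_of_natDegree_lt_card_of_eval_eq_zero _ (ι := S)
      (f := fun x => s x) ?_ ?_ ?_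
    · intro x y hxy
      have hx := hs x (hS x x.2).1
      have hy := hs y (hS y y.2).1
      simp only at hxy
      exact Subtype.ext (by rw [← hx, ← hy, hxy])
    · intro x
      rw [eval_lineRestrict, hs x (hS x x.2).1]
      exact (hS x x.2).2
    · rw [Fintype.card_coe]
      exact (natDegree_lineRestrict_le p u f).trans_lt hcard
  intro x hx
  rw [← hs x hx, ← eval_lineRestrict, h0, Polynomial.eval_zero]

/-- Evaluations at points of a line span a space of dimension at most degree plus one. -/
theorem IsLine.rankOn_eval_le {l : AffineSubspace ℝ (EuclideanSpace ℝ (Fin d))} (hl : IsLine l)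
    {V : Submodule ℝ (MvPolynomial (Fin d) ℝ)} {D : ℕ} (hV : ∀ f ∈ V, f.totalDegree ≤ D)
    {ι : Type*} (pt : ι → EuclideanSpace ℝ (Fin d)) (Y : Finset ι) (hY : ∀ x ∈ Y, pt x ∈ l) :
    rankOn (fun x => (MvPolynomial.aeval (pt x).ofLp : MvPolynomial (Fin d) ℝ →ₐ[ℝ] ℝ).toLinearMap
      |>.domRestrict V) Y ≤ D + 1 := by
  obtain ⟨p, hp⟩ := hl.nonempty
  obtain ⟨u, hu, hpar⟩ := hl.exists_param hp
  -- Evaluation at `p + s • u` is a combination, with coefficients `s ^ j`, of the `D + 1`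
  -- coefficient functionals of the restriction.
  let c : Fin (D + 1) → V →ₗ[ℝ] ℝ := fun j =>
    (Polynomial.lcoeff ℝ j ∘ₗ (lineRestrict p u).toLinearMap).domRestrict V
  have hle : Submodule.span ℝ ((fun x => (MvPolynomial.aeval (pt x).ofLp :
      MvPolynomial (Fin d) ℝ →ₐ[ℝ] ℝ).toLinearMap.domRestrict V) '' Y) ≤
      Submodule.span ℝ (Set.range c) := by
    refine Submodule.span_le.2 ?_
    rintro _ ⟨x, hx, rfl⟩
    obtain ⟨s, hs⟩ := (hpar _).1 (hY x hx)
    have : (MvPolynomial.aeval (pt x).ofLp :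
        MvPolynomial (Fin d) ℝ →ₐ[ℝ] ℝ).toLinearMap.domRestrict V = ∑ j : Fin (D + 1), s ^ (j : ℕ) • c j := by
      ext f
      have hdeg : (lineRestrict p u (f : MvPolynomial (Fin d) ℝ)).natDegree < D + 1 :=
        Nat.lt_succ_of_le ((natDegree_lineRestrict_le p u _).trans (hV f f.2))
      have := Polynomial.eval_eq_sum_range' hdeg s
      rw [eval_lineRestrict, hs, sum_range] at this
      simp only [LinearMap.domRestrict_apply, AlgHom.toLinearMap_apply, this, LinearMap.sum_apply,
        LinearMap.smul_apply, smul_eq_mul, c, LinearMap.comp_apply, Polynomial.lcoeff_apply,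
        mul_comm]
    simp only [this]
    exact Submodule.sum_mem _ fun j _ => Submodule.smul_mem _ _ (Submodule.subset_span ⟨j, rfl⟩)
  have : Module.Finite ℝ (Submodule.span ℝ (Set.range c)) :=
    FiniteDimensional.span_of_finite ℝ (Set.finite_range c)
  refine (Submodule.finrank_mono hle).trans ((finrank_range_le_card c).trans ?_)
  simp

theorem finrank_restrictDegree (d m : ℕ) :
    finrank ℝ (MvPolynomial.restrictDegree (Fin d) ℝ m) = (m + 1) ^ d := by
  let φ : {n : Fin d →₀ ℕ | ∀ i, n i ≤ m} ≃ (Fin d → Fin (m + 1)) :=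
    { toFun := fun n i => ⟨n.1 i, Nat.lt_succ_of_le (n.2 i)⟩
      invFun := fun g => ⟨Finsupp.equivFunOnFinite.symm fun i => (g i : ℕ),
        fun i => Nat.le_of_lt_succ (g i).2⟩
      left_inv := fun n => Subtype.ext (Finsupp.ext fun i => rfl)
      right_inv := fun g => rfl }
  rw [MvPolynomial.restrictDegree,
    finrank_eq_nat_card_basis (MvPolynomial.basisRestrictSupport ℝ _), Nat.card_congr φ]
  simp

theorem totalDegree_le_of_mem_restrictDegree {m : ℕ} {f : MvPolynomial (Fin d) ℝ}
    (hf : f ∈ MvPolynomial.restrictDegree (Fin d) ℝ m) : f.totalDegree ≤ d * m := by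
  refine Finset.sup_le fun s hs => ?_
  rw [Finsupp.sum_fintype _ _ fun _ => rfl]
  have := sum_le_card_nsmul univ s m fun i _ => (MvPolynomial.mem_restrictDegree _ _ _).1 hf s hs i
  simpa using this

end RichLines

/-! ### Tangent hyperplanes at smooth points. -/

namespace RichLines

open Finset Module

/-- A dense bipartite incidence relation has a sub-relation with large minimum degrees. -/
theorem exists_large_min_degree {α β : Type*} (P : Finset α) (L : Finset β) (I : α → β → Prop)
    [∀ p l, Decidable (I p l)] {a b : ℝ} (ha : 0 ≤ a)
    (h : a * #P + b * #L < ∑ l ∈ L, (#{p ∈ P | I p l} : ℝ)) :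
    ∃ P' ⊆ P, ∃ L' ⊆ L, L'.Nonempty ∧ (∀ p ∈ P', a ≤ #{l ∈ L' | I p l}) ∧
      ∀ l ∈ L', b ≤ #{p ∈ P' | I p l} := by
  classical
  let ε : α → β → ℝ := fun p l => if I p l then 1 else 0
  -- At a maximiser, deleting a vertex of too small degree would increase `φ`; a positive maximum
  -- keeps `L'` nonempty.
  let φ : Finset α × Finset β → ℝ := fun q =>
    ∑ l ∈ q.2, ∑ p ∈ q.1, ε p l - a * #q.1 - b * #q.2
  obtain ⟨⟨P', L'⟩, hmem, hmax⟩ := exists_max_image (P.powerset ×ˢ L.powerset) φ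
    ⟨(∅, ∅), by simp⟩
  rw [mem_product, mem_powerset, mem_powerset] at hmem
  simp only at hmem
  have hpos : 0 < φ (P', L') := by
    refine lt_of_lt_of_le ?_ (hmax (P, L) (by simp))
    simp only [φ, ε, sum_boole]
    linarith
  refine ⟨P', hmem.1, L', hmem.2, ?_, fun p hp => ?_, fun l hl => ?_⟩
  · rw [nonempty_iff_ne_empty]
    rintro rfl
    simp only [φ, sum_empty, card_empty, Nat.cast_zero, mul_zero] at hpos
    have : 0 ≤ a * #P' := by positivity
    linarith
  · have h1 := hmax (P'.erase p, L')
      (mem_product.2 ⟨mem_powerset.2 ((erase_subset _ _).trans hmem.1), mem_powerset.2 hmem.2⟩)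
    have h2 : ∑ l ∈ L', ∑ p ∈ P', ε p l = ∑ l ∈ L', ε p l + ∑ l ∈ L', ∑ p ∈ P'.erase p, ε p l := by
      rw [← sum_add_distrib]
      exact sum_congr rfl fun l _ => (add_sum_erase P' (fun p => ε p l) hp).symm
    have h3 : (#(P'.erase p) : ℝ) = #P' - 1 := by
      rw [card_erase_of_mem hp, Nat.cast_pred (card_pos.2 ⟨p, hp⟩)]
    have h4 : ∑ l ∈ L', ε p l = #{l ∈ L' | I p l} := by simp only [ε, sum_boole]
    simp only [φ] at h1
    rw [h2, h3, h4] at h1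
    linarith
  · have h1 := hmax (P', L'.erase l)
      (mem_product.2 ⟨mem_powerset.2 hmem.1, mem_powerset.2 ((erase_subset _ _).trans hmem.2)⟩)
    have h2 := add_sum_erase L' (fun l => ∑ p ∈ P', ε p l) hl
    have h3 : (#(L'.erase l) : ℝ) = #L' - 1 := by
      rw [card_erase_of_mem hl, Nat.cast_pred (card_pos.2 ⟨l, hl⟩)]
    have h4 : ∑ p ∈ P', ε p l = #{p ∈ P' | I p l} := by simp only [ε, sum_boole]
    simp only [φ] at h1
    rw [← h2, h3, h4] at h1
    linarith

theorem exists_pderiv_ne_zero {σ : Type*} {g : MvPolynomial σ ℝ}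
    (hg : ∀ a, g ≠ MvPolynomial.C a) : ∃ i, MvPolynomial.pderiv i g ≠ 0 := by
  classical
  by_contra! h
  refine hg (MvPolynomial.coeff 0 g) (MvPolynomial.ext _ _ fun m => ?_)
  rw [MvPolynomial.coeff_C]
  split_ifs with hm
  · rw [hm]
  · obtain ⟨i, hi⟩ : ∃ i, m i ≠ 0 := by
      by_contra! h'
      exact hm (Finsupp.ext fun i => (h' i).symm)
    have hc := MvPolynomial.coeff_pderiv (i := i) g (m - Finsupp.single i 1)
    have hm' : m - Finsupp.single i 1 + Finsupp.single i 1 = m :=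
      tsub_add_cancel_of_le (Finsupp.single_le_iff.2 (Nat.one_le_iff_ne_zero.2 hi))
    rw [h i, MvPolynomial.coeff_zero, hm'] at hc
    exact (mul_eq_zero.1 hc.symm).resolve_right (Nat.cast_add_one_ne_zero _)

theorem totalDegree_pderiv_lt {σ : Type*} {g : MvPolynomial σ ℝ} {i : σ}
    (h : MvPolynomial.pderiv i g ≠ 0) :
    (MvPolynomial.pderiv i g).totalDegree < g.totalDegree := by
  classical
  have key : ∀ s ∈ (MvPolynomial.pderiv i g).support,
      (s.sum fun _ e => e) < g.totalDegree := by
    intro s hs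
    rw [MvPolynomial.mem_support_iff, MvPolynomial.coeff_pderiv] at hs
    have := MvPolynomial.le_totalDegree (MvPolynomial.mem_support_iff.2 (left_ne_zero_of_mul hs))
    rw [Finsupp.sum_add_index' (fun _ => rfl) (fun _ _ _ => rfl),
      Finsupp.sum_single_index rfl] at this
    exact this
  obtain ⟨s, hs⟩ := MvPolynomial.support_nonempty.2 h
  exact (Finset.sup_lt_iff ((Nat.zero_le _).trans_lt (key s hs))).2 key

variable {d : ℕ}

/-- The hyperplane through `p` with normal covector `w`. -/
theorem exists_hyperplane_of_ne_zero (p : EuclideanSpace ℝ (Fin d)) {w : Fin d → ℝ} (hw : w ≠ 0) :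
    ∃ H : AffineSubspace ℝ (EuclideanSpace ℝ (Fin d)), IsHyperplane H ∧
      ∀ u : EuclideanSpace ℝ (Fin d), ∑ i, u i * w i = 0 → p + u ∈ H := by
  let φ : Dual ℝ (EuclideanSpace ℝ (Fin d)) :=
    ∑ i, w i • (EuclideanSpace.proj i : EuclideanSpace ℝ (Fin d) →L[ℝ] ℝ).toLinearMap
  have hφ : ∀ u, φ u = ∑ i, u i * w i := fun u => by simp [φ, mul_comm]
  have hφ0 : φ ≠ 0 := by
    obtain ⟨i, hi⟩ := Function.ne_iff.1 hw
    intro h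
    have := hφ (EuclideanSpace.single i 1)
    rw [h] at this
    simp at this
    exact hi this.symm
  refine ⟨AffineSubspace.mk' p (LinearMap.ker φ), ⟨⟨p, AffineSubspace.self_mem_mk' _ _⟩, ?_⟩,
    fun u hu => ?_⟩
  · rw [AffineSubspace.direction_mk']
    exact Module.Dual.finrank_ker_add_one_of_ne_zero hφ0
  · rw [AffineSubspace.mem_mk', vsub_eq_sub, add_sub_cancel_left, LinearMap.mem_ker, hφ, hu]

/-- If many rich lines lie in the zero set of a polynomial of small degree, the tangent hyperplane
at a suitable smooth point is rich. -/
theorem exists_hyperplane_of_vanishing {P : Finset (EuclideanSpace ℝ (Fin d))}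
    {L : Finset (AffineSubspace ℝ (EuclideanSpace ℝ (Fin d)))} (hL : ∀ l ∈ L, IsLine l)
    (hne : L.Nonempty) {r : ℕ} (hr : 2 ≤ r)
    (hrich : ∀ l ∈ L, r ≤ ((P : Set (EuclideanSpace ℝ (Fin d))) ∩ l).ncard)
    {f : MvPolynomial (Fin d) ℝ} (hf : f ≠ 0) (hdeg : 2 * f.totalDegree < r)
    (hvan : ∀ l ∈ L, ∀ x ∈ l, MvPolynomial.aeval x.ofLp f = 0) :
    ∃ H : AffineSubspace ℝ (EuclideanSpace ℝ (Fin d)), IsHyperplane H ∧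
      (#L * r ^ 2 : ℝ) ≤ 8 * #P * ((P : Set (EuclideanSpace ℝ (Fin d))) ∩ H).ncard := by
  classical
  have hncard : ∀ l : AffineSubspace ℝ (EuclideanSpace ℝ (Fin d)),
      ((P : Set (EuclideanSpace ℝ (Fin d))) ∩ l).ncard = #{p ∈ P | p ∈ l} := by
    intro l
    rw [← Set.ncard_coe_finset]
    congr 1
    ext x
    simp
  simp only [hncard] at hrich ⊢
  have hLpos : (0 : ℝ) < #L := by exact_mod_cast hne.card_pos
  have hr0 : (0 : ℝ) < r := by positivity
  have hPpos : (0 : ℝ) < #P := by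
    obtain ⟨l, hl⟩ := hne
    have := (hrich l hl).trans (card_filter_le _ _)
    exact_mod_cast (by omega : 0 < #P)
  -- These thresholds cost `3/4 * #L * r` in total, below the at least `#L * r` incidences.
  obtain ⟨P', hP', L', hL', hne', hdegP, hdegL⟩ := exists_large_min_degree P L (fun p l => p ∈ l)
    (a := #L * r / (4 * #P)) (b := r / 2) (by positivity) (by
      have h1 : ∑ l ∈ L, (r : ℝ) ≤ ∑ l ∈ L, (#{p ∈ P | p ∈ l} : ℝ) :=
        sum_le_sum fun l hl => by exact_mod_cast hrich l hl
      rw [sum_const, nsmul_eq_mul] at h1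
      refine lt_of_lt_of_le ?_ h1
      have : (#L * r / (4 * #P) : ℝ) * #P = #L * r / 4 := by field_simp
      rw [this]
      nlinarith [mul_pos hLpos hr0])
  have hex : ∃ k, ∃ g : MvPolynomial (Fin d) ℝ, g ≠ 0 ∧ g.totalDegree = k ∧
      ∀ l ∈ L', ∀ x ∈ l, MvPolynomial.aeval x.ofLp g = 0 :=
    ⟨_, f, hf, rfl, fun l hl => hvan l (hL' hl)⟩
  obtain ⟨g, hg, hgk, hgvan⟩ := Nat.find_spec hex
  have hmin : ∀ h : MvPolynomial (Fin d) ℝ, h ≠ 0 → h.totalDegree < g.totalDegree →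
      ∃ l ∈ L', ∃ x ∈ l, MvPolynomial.aeval x.ofLp h ≠ 0 := by
    intro h hh hlt
    rw [hgk] at hlt
    by_contra! hcon
    exact Nat.find_min hex hlt ⟨h, hh, rfl, hcon⟩
  have hgD : g.totalDegree ≤ f.totalDegree := by
    rw [hgk]
    exact Nat.find_min' hex ⟨f, hf, rfl, fun l hl => hvan l (hL' hl)⟩
  obtain ⟨i, hi⟩ : ∃ i, MvPolynomial.pderiv i g ≠ 0 := by
    refine exists_pderiv_ne_zero fun a ha => hg ?_
    obtain ⟨l, hl⟩ := hne'
    obtain ⟨x, hx⟩ := (hL l (hL' hl)).nonempty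
    have := hgvan l hl x hx
    rw [ha, MvPolynomial.algHom_C] at this
    simp only [Algebra.algebraMap_self, RingHom.id_apply] at this
    rw [ha, this, MvPolynomial.C_0]
  obtain ⟨l, hl, x, hx, hxne⟩ := hmin _ hi (totalDegree_pderiv_lt hi)
  -- The derivative has degree below `r / 2`, while `l` carries at least `r / 2` points of `P'`; it
  -- cannot vanish at all of them.
  obtain ⟨p, hpP, hpl, hpne⟩ : ∃ p ∈ P', p ∈ l ∧
      MvPolynomial.aeval p.ofLp (MvPolynomial.pderiv i g) ≠ 0 := by
    by_contra! hcon
    refine hxne ((hL l (hL' hl)).aeval_eq_zero (S := {p ∈ P' | p ∈ l}) (fun y hy => ?_) ?_ x hx)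
    · obtain ⟨h1, h2⟩ := mem_filter.1 hy
      exact ⟨h2, hcon y h1 h2⟩
    · have h1 := totalDegree_pderiv_lt hi
      have h2 := hdegL l hl
      have h3 : r ≤ 2 * #{p ∈ P' | p ∈ l} := by
        have : (r : ℝ) ≤ 2 * #{p ∈ P' | p ∈ l} := by linarith
        exact_mod_cast this
      omega
  obtain ⟨H, hH, hHmem⟩ := exists_hyperplane_of_ne_zero p
    (w := fun j => MvPolynomial.aeval p.ofLp (MvPolynomial.pderiv j g))
    fun h => hpne (congrFun h i)
  refine ⟨H, hH, ?_⟩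
  have hlH : ∀ l' ∈ L', p ∈ l' → ∀ x ∈ l', x ∈ H := by
    intro l' hl' hpl' x hx
    obtain ⟨u, -, hpar⟩ := (hL l' (hL' hl')).exists_param hpl'
    have h0 : lineRestrict p u g = 0 := Polynomial.funext fun s => by
      rw [eval_lineRestrict, Polynomial.eval_zero]
      exact hgvan l' hl' _ ((hpar _).2 ⟨s, rfl⟩)
    have h1 := congrArg (Polynomial.eval 0) (derivative_lineRestrict p u g)
    rw [h0, Polynomial.derivative_zero, Polynomial.eval_zero, Polynomial.eval_finsetSum] at h1
    simp only [Polynomial.eval_mul, Polynomial.eval_C, eval_lineRestrict, zero_smul,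
      add_zero] at h1
    obtain ⟨s, rfl⟩ := (hpar x).1 hx
    refine hHmem _ ?_
    simp only [PiLp.smul_apply, smul_eq_mul, mul_assoc]
    rw [← mul_sum, ← h1, mul_zero]
  -- Lines through `p` meet only there, so each contributes `r - 1` new points, counted in all of
  -- `P`.
  have hcount : #{l ∈ L' | p ∈ l} * (r - 1) ≤ #{q ∈ P | q ∈ H} := by
    have hsub : ({l ∈ L' | p ∈ l}.biUnion fun l => {q ∈ P | q ∈ l}.erase p) ⊆ {q ∈ P | q ∈ H} := by
      intro q hq
      obtain ⟨l', hl', hq⟩ := mem_biUnion.1 hq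
      obtain ⟨hl', hpl'⟩ := mem_filter.1 hl'
      obtain ⟨hqP, hql'⟩ := mem_filter.1 (mem_of_mem_erase hq)
      exact mem_filter.2 ⟨hqP, hlH l' hl' hpl' q hql'⟩
    refine le_trans ?_ (card_le_card hsub)
    rw [card_biUnion]
    · rw [← smul_eq_mul]
      refine card_nsmul_le_sum _ _ _ fun l' hl' => ?_
      have := hrich l' (hL' (mem_filter.1 hl').1)
      exact (Nat.sub_le_sub_right this 1).trans pred_card_le_card_erase
    · intro l₁ h₁ l₂ h₂ h₁₂
      obtain ⟨h₁, hp₁⟩ := mem_filter.1 h₁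
      obtain ⟨h₂, hp₂⟩ := mem_filter.1 h₂
      refine disjoint_left.2 fun q hq₁ hq₂ => h₁₂ ?_
      exact (hL _ (hL' h₁)).eq_of_mem (hL _ (hL' h₂)) (ne_of_mem_erase hq₁).symm hp₁
        (mem_filter.1 (mem_of_mem_erase hq₁)).2 hp₂ (mem_filter.1 (mem_of_mem_erase hq₂)).2
  have h1 := hdegP p hpP
  have h2 : (#{l ∈ L' | p ∈ l} * (r - 1) : ℝ) ≤ #{q ∈ P | q ∈ H} := by
    have : ((r - 1 : ℕ) : ℝ) = r - 1 := by push_cast [Nat.cast_sub (by omega : 1 ≤ r)]; ring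
    rw [← this]
    exact_mod_cast hcount
  have h3 : (r : ℝ) / 2 ≤ r - 1 := by
    have : (2 : ℝ) ≤ r := by exact_mod_cast hr
    linarith
  have h4 : (#L * r / (4 * #P) : ℝ) * (r / 2) ≤ #{q ∈ P | q ∈ H} :=
    (mul_le_mul h1 h3 (by positivity) (Nat.cast_nonneg _)).trans h2
  have h5 : (#L * r / (4 * #P) : ℝ) * (r / 2) = #L * r ^ 2 / (8 * #P) := by
    field_simp
    ring
  rw [h5, div_le_iff₀ (by positivity)] at h4
  linarith

end RichLines

/-! ### One polynomial for most lines, and the conclusion. -/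

namespace RichLines

open Finset Module

variable {d : ℕ}

theorem card_lines_le_sq {P : Finset (EuclideanSpace ℝ (Fin d))}
    {L : Finset (AffineSubspace ℝ (EuclideanSpace ℝ (Fin d)))} (hL : ∀ l ∈ L, IsLine l)
    (hrich : ∀ l ∈ L, 2 ≤ ((P : Set (EuclideanSpace ℝ (Fin d))) ∩ l).ncard) : #L ≤ #P ^ 2 := by
  classical
  have h : ∀ l ∈ L, ∃ q : EuclideanSpace ℝ (Fin d) × EuclideanSpace ℝ (Fin d),
      q.1 ∈ P ∧ q.2 ∈ P ∧ q.1 ∈ l ∧ q.2 ∈ l ∧ q.1 ≠ q.2 := by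
    intro l hl
    obtain ⟨x, hx, y, hy, hxy⟩ := (Set.one_lt_ncard
      (P.finite_toSet.subset Set.inter_subset_left)).1 (hrich l hl)
    exact ⟨(x, y), hx.1, hy.1, hx.2, hy.2, hxy⟩
  choose! q h1 h2 h3 h4 h5 using h
  rw [sq, ← card_product]
  refine card_le_card_of_injOn q (fun l hl => mem_product.2 ⟨h1 l hl, h2 l hl⟩) ?_
  intro l hl l' hl' hq
  exact (hL l hl).eq_of_mem (hL l' hl') (h5 l hl) (h3 l hl) (h4 l hl)
    (hq ▸ h3 l' hl') (hq ▸ h4 l' hl')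

/-- Up to `4 n² / (r (m + 1) ^ d)` exceptions, `r`-rich lines lie in the zero set of a single
nonzero polynomial of degree at most `d m`. -/
theorem exists_polynomial_vanishing_on_most_lines {P : Finset (EuclideanSpace ℝ (Fin d))}
    {L : Finset (AffineSubspace ℝ (EuclideanSpace ℝ (Fin d)))} (hL : ∀ l ∈ L, IsLine l) {r m : ℕ}
    (hr : 4 * (d * m + 1) ≤ r)
    (hrich : ∀ l ∈ L, r ≤ ((P : Set (EuclideanSpace ℝ (Fin d))) ∩ l).ncard) :
    ∃ f : MvPolynomial (Fin d) ℝ, f ≠ 0 ∧ f.totalDegree ≤ d * m ∧ ∃ L₁ ⊆ L,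
      #L₁ * r * (m + 1) ^ d ≤ 4 * #P ^ 2 ∧
      ∀ l ∈ L, l ∉ L₁ → ∀ x ∈ l, MvPolynomial.aeval x.ofLp f = 0 := by
  classical
  let V := MvPolynomial.restrictDegree (Fin d) ℝ m
  have hV : ∀ f ∈ V, f.totalDegree ≤ d * m := fun f hf => totalDegree_le_of_mem_restrictDegree hf
  have hfin : finrank ℝ V = (m + 1) ^ d := finrank_restrictDegree d m
  have : Nontrivial V := nontrivial_of_finrank_pos (R := ℝ) (by rw [hfin]; positivity)
  let e : P → Dual ℝ V := fun x => (MvPolynomial.aeval (x : EuclideanSpace ℝ (Fin d)).ofLp :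
    MvPolynomial (Fin d) ℝ →ₐ[ℝ] ℝ).toLinearMap.domRestrict V
  obtain ⟨E, hE, hcount⟩ := exists_subspace_card_blocks_le e
  obtain ⟨f, hfE, hf0⟩ := E.exists_mem_ne_zero_of_ne_bot hE
  let good : EuclideanSpace ℝ (Fin d) → Prop := fun x =>
    ∃ f ∈ E, MvPolynomial.aeval x.ofLp (f : MvPolynomial (Fin d) ℝ) ≠ 0
  let Y : AffineSubspace ℝ (EuclideanSpace ℝ (Fin d)) → Finset P := fun l =>
    {x ∈ P | x ∈ l ∧ good x}.subtype (· ∈ P)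
  have hYmem : ∀ l (x : P), x ∈ Y l ↔ (x : EuclideanSpace ℝ (Fin d)) ∈ l ∧ good x := by
    intro l x
    simp [Y]
  have hYcard : ∀ l, #(Y l) = #{x ∈ P | x ∈ l ∧ good x} := by
    intro l
    rw [card_subtype, filter_true_of_mem fun x hx => (mem_filter.1 hx).1]
  -- The exceptional lines have at least `⌈r / 2⌉` points not killed by `E`, against rank at most `d
  -- * m + 1 ≤ r / 4`. Any other line has more than `d * m` zeros of `f`.
  refine ⟨f, fun h => hf0 (Subtype.ext h), hV f f.2, {l ∈ L | (r + 1) / 2 ≤ #(Y l)},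
    filter_subset _ _, ?_, fun l hl hlL => ?_⟩
  · have h := hcount {l ∈ L | (r + 1) / 2 ≤ #(Y l)} Y ((r + 1) / 2) (by omega)
      (fun l hl => (mem_filter.1 hl).2)
      (fun l hl => by
        have := (hL l (mem_filter.1 hl).1).rankOn_eval_le hV
          (fun x : P => (x : EuclideanSpace ℝ (Fin d))) (Y l) fun x hx => ((hYmem l x).1 hx).1
        have h2 : rankOn e (Y l) ≤ d * m + 1 := this
        omega)
      (fun l _ x hx => ((hYmem l x).1 hx).2)
      (fun l hl l' hl' hne x hx y hy hx' hy' => by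
        by_contra hxy
        exact hne ((hL l (mem_filter.1 hl).1).eq_of_mem (hL l' (mem_filter.1 hl').1)
          (fun h => hxy (Subtype.ext h)) ((hYmem l x).1 hx).1 ((hYmem l y).1 hy).1
          ((hYmem l' x).1 hx').1 ((hYmem l' y).1 hy').1))
    rw [hfin, Fintype.card_coe] at h
    set N := #{l ∈ L | (r + 1) / 2 ≤ #(Y l)}
    have h2 : r ≤ 2 * ((r + 1) / 2) := by omega
    calc N * r * (m + 1) ^ d ≤ N * (2 * ((r + 1) / 2)) * (m + 1) ^ d := by gcongr
      _ = 2 * (N * ((r + 1) / 2) * (m + 1) ^ d) := by ring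
      _ ≤ 2 * (2 * #P ^ 2) := by gcongr
      _ = _ := by ring
  · have hlt : #(Y l) < (r + 1) / 2 := by
      by_contra h
      exact hlL (mem_filter.2 ⟨hl, not_lt.1 h⟩)
    have hn : ((P : Set (EuclideanSpace ℝ (Fin d))) ∩ l).ncard = #{x ∈ P | x ∈ l} := by
      rw [← Set.ncard_coe_finset]
      congr 1
      ext x
      simp
    have hge := hrich l hl
    have hsplit := card_filter_add_card_filter_not (s := {x ∈ P | x ∈ l}) good
    rw [filter_filter, ← hYcard, ← hn] at hsplit
    refine (hL l hl).aeval_eq_zero (S := {x ∈ {x ∈ P | x ∈ l} | ¬ good x}) (fun x hx => ?_) ?_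
    · obtain ⟨h1, h2⟩ := mem_filter.1 hx
      refine ⟨(mem_filter.1 h1).2, ?_⟩
      by_contra h
      exact h2 ⟨f, hfE, h⟩
    · have := hV f f.2
      omega

end RichLines

theorem theorem2p2 (d : ℕ) (hd : 1 ≤ d) :
    ∃ K N : ℝ, 0 < K ∧ 0 < N ∧
      ∀ (r : ℕ), 2 ≤ r →
      ∀ (P : Finset (EuclideanSpace ℝ (Fin d)))
        (L : Finset (AffineSubspace ℝ (EuclideanSpace ℝ (Fin d)))),
        (∀ l ∈ L, RichLines.IsLine l) →
        (∀ l ∈ L, r ≤ ((P : Set (EuclideanSpace ℝ (Fin d))) ∩ l).ncard) →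
        K * ((P.card : ℝ) ^ 2 / (r : ℝ) ^ (d + 1)) ≤ (L.card : ℝ) →
        ∃ H : AffineSubspace ℝ (EuclideanSpace ℝ (Fin d)),
          RichLines.IsHyperplane H ∧
          N * ((P.card : ℝ) / (r : ℝ) ^ (d - 1)) ≤
            ((((P : Set (EuclideanSpace ℝ (Fin d))) ∩ H).ncard : ℕ) : ℝ) := by
  classical
  -- The first summand makes the exceptional lines at most half of `L`; the second excludes `r < 4`,
  -- where `#L ≤ #P ^ 2` would be violated. In `K / 16`, a factor 2 comes from discarding that half
  -- and 8 from the hyperplane bound.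
  set K : ℝ := 8 * (8 * d) ^ d + 4 ^ (d + 1) with hK
  have hK0 : 0 < K := by positivity
  refine ⟨K, K / 16, hK0, by positivity, fun r hr P L hL hrich hcard => ?_⟩
  have hr0 : (0 : ℝ) < r := by positivity
  rw [mul_div_assoc', div_le_iff₀ (by positivity)] at hcard
  rcases P.eq_empty_or_nonempty with hP | hP
  · obtain ⟨H, hH, -⟩ := RichLines.exists_hyperplane_of_ne_zero (0 : EuclideanSpace ℝ (Fin d))
      (w := fun _ => 1) fun h => one_ne_zero (congrFun h ⟨0, hd⟩)
    exact ⟨H, hH, by simp [hP]⟩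
  have hPpos : (0 : ℝ) < P.card := by exact_mod_cast hP.card_pos
  have hr4 : 4 ≤ r := by
    by_contra! hlt
    have h1 : (L.card : ℝ) ≤ (P.card : ℝ) ^ 2 := by
      exact_mod_cast RichLines.card_lines_le_sq hL fun l hl => hr.trans (hrich l hl)
    have h2 : (r : ℝ) ^ (d + 1) ≤ 4 ^ (d + 1) :=
      pow_le_pow_left₀ hr0.le (by exact_mod_cast hlt.le) _
    have h3 : (L.card : ℝ) * r ^ (d + 1) ≤ (P.card : ℝ) ^ 2 * 4 ^ (d + 1) := by gcongr
    have h4 : 0 < 8 * (8 * (d : ℝ)) ^ d * (P.card : ℝ) ^ 2 := by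
      have : (0 : ℝ) < d := by exact_mod_cast hd
      positivity
    rw [hK] at hcard
    linarith
  -- The degree must be small enough for low rank on lines, yet of order `r / d`, so that `finrank V
  -- = (m + 1) ^ d` has order `r ^ d`.
  obtain ⟨m, hm, hrm⟩ : ∃ m, 4 * (d * m + 1) ≤ r ∧ r ≤ 8 * d * (m + 1) := by
    refine ⟨(r - 4) / (4 * d), ?_, ?_⟩
    · have := Nat.div_mul_le_self (r - 4) (4 * d)
      have h2 : (r - 4) / (4 * d) * (4 * d) = 4 * (d * ((r - 4) / (4 * d))) := by ring
      omega
    · have := Nat.lt_mul_div_succ (r - 4) (by omega : 0 < 4 * d)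
      have h2 : 8 * d * ((r - 4) / (4 * d) + 1) = 2 * (4 * d * ((r - 4) / (4 * d) + 1)) := by ring
      have h3 : 8 * 1 * 1 ≤ 8 * d * ((r - 4) / (4 * d) + 1) :=
        Nat.mul_le_mul (Nat.mul_le_mul_left 8 hd) (Nat.le_add_left 1 _)
      omega
  obtain ⟨f, hf, hfdeg, L₁, hL₁, hL₁card, hvan⟩ :=
    RichLines.exists_polynomial_vanishing_on_most_lines hL hm hrich
  have hL₁' : 2 * (L₁.card : ℝ) ≤ L.card := by
    have h1 : (L₁.card * r * (m + 1) ^ d : ℝ) ≤ 4 * (P.card : ℝ) ^ 2 := by exact_mod_cast hL₁card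
    have h2 : (r : ℝ) ≤ 8 * d * (m + 1) := by exact_mod_cast hrm
    refine le_of_mul_le_mul_right ?_ (by positivity : (0 : ℝ) < r ^ (d + 1))
    calc 2 * (L₁.card : ℝ) * r ^ (d + 1) = 2 * (L₁.card * r * r ^ d) := by ring
      _ ≤ 2 * (L₁.card * r * (8 * d * (m + 1)) ^ d) := by gcongr
      _ = 2 * (8 * d) ^ d * (L₁.card * r * (m + 1) ^ d) := by rw [mul_pow _ ((m : ℝ) + 1)]; ring
      _ ≤ 2 * (8 * d) ^ d * (4 * (P.card : ℝ) ^ 2) := by gcongr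
      _ ≤ K * (P.card : ℝ) ^ 2 := by
        have : 0 ≤ (4 : ℝ) ^ (d + 1) * (P.card : ℝ) ^ 2 := by positivity
        rw [hK]; linarith
      _ ≤ _ := hcard
  have hLpos : (0 : ℝ) < L.card := by
    refine pos_of_mul_pos_left (lt_of_lt_of_le ?_ hcard) (by positivity)
    positivity
  have hsd : ((L \ L₁).card : ℝ) = L.card - L₁.card := by
    rw [Finset.card_sdiff_of_subset hL₁, Nat.cast_sub (Finset.card_le_card hL₁)]
  have hne : (L \ L₁).Nonempty := by
    rw [← Finset.card_pos]
    have : (0 : ℝ) < (L \ L₁).card := by rw [hsd]; linarith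
    exact_mod_cast this
  have hmem : ∀ l ∈ L \ L₁, l ∈ L := fun l hl => (Finset.mem_sdiff.1 hl).1
  obtain ⟨H, hH, hHcard⟩ := RichLines.exists_hyperplane_of_vanishing
    (fun l hl => hL l (hmem l hl)) hne hr (fun l hl => hrich l (hmem l hl)) hf (by omega)
    fun l hl => hvan l (hmem l hl) (Finset.mem_sdiff.1 hl).2
  refine ⟨H, hH, ?_⟩
  set c : ℝ := (((P : Set (EuclideanSpace ℝ (Fin d))) ∩ H).ncard : ℝ)
  rw [mul_div_assoc', div_le_iff₀ (by positivity)]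
  refine le_of_mul_le_mul_right ?_ hPpos
  have hpow : (r : ℝ) ^ (d + 1) = r ^ 2 * r ^ (d - 1) := by
    rw [← pow_add]; congr 1; omega
  have h1 : (L.card : ℝ) ≤ 2 * (L \ L₁).card := by rw [hsd]; linarith
  have h2 : K * (P.card : ℝ) ^ 2 ≤ 16 * (c * r ^ (d - 1) * P.card) := by
    calc K * (P.card : ℝ) ^ 2 ≤ L.card * r ^ (d + 1) := hcard
      _ ≤ 2 * (L \ L₁).card * r ^ (d + 1) := by gcongr
      _ = 2 * ((L \ L₁).card * r ^ 2) * r ^ (d - 1) := by rw [hpow]; ring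
      _ ≤ 2 * (8 * P.card * c) * r ^ (d - 1) := by gcongr
      _ = _ := by ring
  linarith
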